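/- Let $I\subseteq\mathbb R$ be a nonempty open interval and let $A_1,A_2,A_3:I\to\mathbb R\setminus\{0\}$ be smooth ($C^\infty$) functions, no two of which are the same function. The corresponding proper (diagonal) Bianchi I space-time is $M=I\times\mathbb R^3$, with coordinates $(t,x^1,x^2,x^3)$ and metric $$g=-dt^2+\sum_{\mu=1}^3 A_\mu(t)^2\,(dx^\mu)^2 .$$ Suppose that its Ricci tensor is non-degenerate, that is, $\det(R_{ab})\neq 0$ at every point of $M$. Let $U\subseteq M$ be a nonempty connected open set (for instance $U=M$). Then every smooth curvature collineation on $U$, that is, every $C^\infty$ vector field $X$ on $U$ with $\mathcal L_X R^a{}_{bcd}=0$ on $U$, is a homothetic vector field on $U$: there is a constant $\psi\in\mathbb R$ with $\mathcal L_X g_{ab}=2\psi g_{ab}$ on $U$ (the Killing case $\psi=0$ is included). Equivalently, no proper Bianchi I space-time with non-degenerate Ricci tensor admits a proper smooth curvature collineation, i.e. one that is not homothetic, on $M$ or on any nonempty connected open subset of $M$. -/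

import Mathlib

open scoped ContDiff

noncomputable section

namespace BianchiI

/-- Coordinates `(x⁰, x¹, x², x³) = (t, x, y, z)`. -/
abbrev Coord := Fin 4 → ℝ

/-- A vector field in coordinates: `X x a` is the component `Xᵃ(x)`. -/
abbrev VectorField := Coord → Fin 4 → ℝ

/-- A metric in coordinates: `g x a b` is the component `g_{ab}(x)`. -/
abbrev Metric := Coord → Matrix (Fin 4) (Fin 4) ℝ

/-- The partial derivative `∂ₐ f` at `x`. -/
def partialDeriv (a : Fin 4) (f : Coord → ℝ) (x : Coord) : ℝ :=
  fderiv ℝ f x (Pi.single a 1)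

/-- Christoffel symbols `Γᵃ_{bc} = ½ gᵃᵈ (∂_b g_{dc} + ∂_c g_{db} - ∂_d g_{bc})`. -/
def christoffel (g : Metric) (a b c : Fin 4) (x : Coord) : ℝ :=
  (1 / 2) * ∑ d, (g x)⁻¹ a d *
    (partialDeriv b (fun y => g y d c) x + partialDeriv c (fun y => g y d b) x
      - partialDeriv d (fun y => g y b c) x)

/-- Riemann tensor
`Rᵃ_{bcd} = ∂_c Γᵃ_{db} - ∂_d Γᵃ_{cb} + Γᵃ_{ce} Γᵉ_{db} - Γᵃ_{de} Γᵉ_{cb}`. -/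
def riemann (g : Metric) (a b c d : Fin 4) (x : Coord) : ℝ :=
  partialDeriv c (christoffel g a d b) x - partialDeriv d (christoffel g a c b) x
    + ∑ e, (christoffel g a c e x * christoffel g e d b x
      - christoffel g a d e x * christoffel g e c b x)

/-- Ricci tensor `R_{bd} = Rᵃ_{bad}`, as a matrix at each point. -/
def ricci (g : Metric) (x : Coord) : Matrix (Fin 4) (Fin 4) ℝ :=
  Matrix.of fun b d => ∑ a, riemann g a b a d x

/-- `(L_X g)_{ab} = Xᶜ ∂_c g_{ab} + g_{cb} ∂_a Xᶜ + g_{ac} ∂_b Xᶜ`. -/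
def lieMetric (X : VectorField) (g : Metric) (a b : Fin 4) (x : Coord) : ℝ :=
  ∑ c, (X x c * partialDeriv c (fun y => g y a b) x
    + g x c b * partialDeriv a (fun y => X y c) x
    + g x a c * partialDeriv b (fun y => X y c) x)

/-- `(L_X R)ᵃ_{bcd} = Xᵉ ∂_e Rᵃ_{bcd} - Rᵉ_{bcd} ∂_e Xᵃ + Rᵃ_{ecd} ∂_b Xᵉ
  + Rᵃ_{bed} ∂_c Xᵉ + Rᵃ_{bce} ∂_d Xᵉ`. -/
def lieRiemann (X : VectorField) (g : Metric) (a b c d : Fin 4) (x : Coord) : ℝ :=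
  ∑ e, (X x e * partialDeriv e (riemann g a b c d) x
    - riemann g e b c d x * partialDeriv e (fun y => X y a) x
    + riemann g a e c d x * partialDeriv b (fun y => X y e) x
    + riemann g a b e d x * partialDeriv c (fun y => X y e) x
    + riemann g a b c e x * partialDeriv d (fun y => X y e) x)

/-- `X` is a smooth (`C^∞`) curvature collineation of `g` on the open set `U`:
`L_X Rᵃ_{bcd} = 0` on `U`. -/
def IsSmoothCC (g : Metric) (U : Set Coord) (X : VectorField) : Prop :=
  ContDiffOn ℝ ∞ X U ∧ ∀ x ∈ U, ∀ a b c d, lieRiemann X g a b c d x = 0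

/-- `X` is a smooth homothetic vector field of `g` on the open set `U`:
`L_X g = 2 ψ g` on `U` with a constant `ψ` (Killing fields, `ψ = 0`, included). -/
def IsSmoothHVF (g : Metric) (U : Set Coord) (X : VectorField) : Prop :=
  ContDiffOn ℝ ∞ X U ∧
    ∃ ψ : ℝ, ∀ x ∈ U, ∀ a b, lieMetric X g a b x = 2 * ψ * g x a b

/-- A proper (smooth) curvature collineation: one that is not homothetic. -/
def IsProperCC (g : Metric) (U : Set Coord) (X : VectorField) : Prop :=
  IsSmoothCC g U X ∧ ¬ IsSmoothHVF g U X

/-- The diagonal metric `ds² = -dt² + ∑_μ A_μ(t)² (dx^μ)²`. -/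
def metric (A : Fin 3 → ℝ → ℝ) : Metric := fun x =>
  Matrix.diagonal (Fin.cons (-1) fun μ => A μ (x 0) ^ 2)

/-- The space-time manifold `I × ℝ³`. -/
def manifold (I : Set ℝ) : Set Coord := {x | x 0 ∈ I}

/-- The data `(I, A₁, A₂, A₃)` define a proper diagonal Bianchi I space-time: `I` is an open
interval, the metric functions are smooth and nowhere zero on `I`, and no two of them are the
same function on `I`. -/
structure IsProperSpacetime (I : Set ℝ) (A : Fin 3 → ℝ → ℝ) : Prop where
  isOpen : IsOpen I
  ordConnected : I.OrdConnected
  nonempty : I.Nonempty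
  smooth : ∀ μ, ContDiffOn ℝ ∞ (A μ) I
  ne_zero : ∀ μ, ∀ t ∈ I, A μ t ≠ 0
  distinct : ∀ μ ν, μ ≠ ν → ∃ t ∈ I, A μ t ≠ A ν t

end BianchiI

end

open scoped ContDiff

noncomputable section

namespace BianchiI

/-! ### Calculus of partial derivatives on an open set. -/

section PartialDeriv

variable {U : Set Coord} {f g : Coord → ℝ} {x : Coord}

/-! The curvature is diagonal in the coordinate planes, with sectional curvatures `K₀μ = Hμ' + Hμ²`
and `Kμν = Hμ Hν`, where `Hμ = Aμ'/Aμ`. The Ricci tensor is then diagonal too, and non-degeneracy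
means in particular that every coordinate direction lies in a plane with `K ≠ 0`.

Read componentwise, `L_X R = 0` says that off-diagonal strain vanishes and that the diagonal strains
of two directions agree wherever the `K` of their plane is nonzero. Where `K` vanishes because some
`Hμ` does, a time derivative recovers the equality (`shear_eq_zero`, `strain_eq`). So `X` is
conformal, with factor `φ = ∂ₜX⁰`.

The remaining components tie `φ` to the derivatives of the `K`. Combined with the equality of mixed
partials of `X`, they give `∂μ∂μφ = Bμ(φ'' + Hμφ')` and `∂μφ' = Hμ∂μφ`, where `Bμ = Aμ²`, and then
`φ'' = 0`; since some `K₀μ ≠ 0`, this forces `φ' = 0`, and then `∂μφ = 0`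
(`partialDeriv_conformalFactor_eq_zero`). Connectedness makes `φ` a constant. -/

lemma differentiableAt_of_contDiffOn (hU : IsOpen U) (hf : ContDiffOn ℝ ∞ f U) (hx : x ∈ U) :
    DifferentiableAt ℝ f x :=
  (hf.contDiffAt (hU.mem_nhds hx)).differentiableAt (by simp)

lemma partialDeriv_congr (hU : IsOpen U) (h : ∀ y ∈ U, f y = g y) (hx : x ∈ U) (a : Fin 4) :
    partialDeriv a f x = partialDeriv a g x := by
  have : f =ᶠ[nhds x] g := Filter.eventually_of_mem (hU.mem_nhds hx) h
  simp only [partialDeriv, this.fderiv_eq]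

@[simp] lemma partialDeriv_const (a : Fin 4) (c : ℝ) : partialDeriv a (fun _ => c) x = 0 := by
  simp [partialDeriv]

lemma partialDeriv_eq_zero_of_const (hU : IsOpen U) {c : ℝ} (h : ∀ y ∈ U, f y = c) (hx : x ∈ U)
    (a : Fin 4) : partialDeriv a f x = 0 := by
  rw [partialDeriv_congr hU h hx a, partialDeriv_const]

lemma partialDeriv_add (hU : IsOpen U) (hf : ContDiffOn ℝ ∞ f U) (hg : ContDiffOn ℝ ∞ g U)
    (hx : x ∈ U) (a : Fin 4) :
    partialDeriv a (fun y => f y + g y) x = partialDeriv a f x + partialDeriv a g x := by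
  simp only [partialDeriv]
  rw [fderiv_fun_add (differentiableAt_of_contDiffOn hU hf hx)
    (differentiableAt_of_contDiffOn hU hg hx)]
  rfl

lemma partialDeriv_sub (hU : IsOpen U) (hf : ContDiffOn ℝ ∞ f U) (hg : ContDiffOn ℝ ∞ g U)
    (hx : x ∈ U) (a : Fin 4) :
    partialDeriv a (fun y => f y - g y) x = partialDeriv a f x - partialDeriv a g x := by
  simp only [partialDeriv]
  rw [fderiv_fun_sub (differentiableAt_of_contDiffOn hU hf hx)
    (differentiableAt_of_contDiffOn hU hg hx)]
  rfl

lemma partialDeriv_mul (hU : IsOpen U) (hf : ContDiffOn ℝ ∞ f U) (hg : ContDiffOn ℝ ∞ g U)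
    (hx : x ∈ U) (a : Fin 4) :
    partialDeriv a (fun y => f y * g y) x
      = partialDeriv a f x * g x + f x * partialDeriv a g x := by
  simp only [partialDeriv]
  rw [fderiv_fun_mul (differentiableAt_of_contDiffOn hU hf hx)
    (differentiableAt_of_contDiffOn hU hg hx)]
  simp
  ring

lemma contDiffOn_partialDeriv (hU : IsOpen U) (hf : ContDiffOn ℝ ∞ f U) (a : Fin 4) :
    ContDiffOn ℝ ∞ (partialDeriv a f) U :=
  (hf.fderiv_of_isOpen hU (by simp)).clm_apply contDiffOn_const

lemma partialDeriv_comm (hU : IsOpen U) (hf : ContDiffOn ℝ ∞ f U) (hx : x ∈ U) (a b : Fin 4) :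
    partialDeriv a (partialDeriv b f) x = partialDeriv b (partialDeriv a f) x := by
  have hd : DifferentiableAt ℝ (fderiv ℝ f) x :=
    ((hf.fderiv_of_isOpen (m := ∞) hU (by simp)).contDiffAt (hU.mem_nhds hx)).differentiableAt
      (by simp)
  have key : ∀ c d : Fin 4, partialDeriv c (partialDeriv d f) x
      = fderiv ℝ (fderiv ℝ f) x (Pi.single c 1) (Pi.single d 1) := by
    intro c d
    change fderiv ℝ (fun y => fderiv ℝ f y (Pi.single d 1)) x (Pi.single c 1) = _
    rw [fderiv_clm_apply hd (differentiableAt_const _)]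
    simp
  have hs : IsSymmSndFDerivAt ℝ f x :=
    (hf.contDiffAt (hU.mem_nhds hx)).isSymmSndFDerivAt
      (by simpa using WithTop.coe_le_coe.2 (le_top : (2 : ℕ∞) ≤ ⊤))
  rw [key, key, hs]

lemma fderiv_eq_zero_of_partialDeriv (h : ∀ a, partialDeriv a f x = 0) : fderiv ℝ f x = 0 := by
  refine ContinuousLinearMap.coe_injective ((Pi.basisFun ℝ (Fin 4)).ext fun a => ?_)
  simpa [partialDeriv] using h a

lemma partialDeriv_time {F : ℝ → ℝ} (hF : DifferentiableAt ℝ F (x 0)) (a : Fin 4) :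
    partialDeriv a (fun y => F (y 0)) x = if a = 0 then deriv F (x 0) else 0 := by
  have h0 : HasFDerivAt (fun y : Coord => y 0)
      (ContinuousLinearMap.proj (R := ℝ) (φ := fun _ : Fin 4 => ℝ) 0) x :=
    (ContinuousLinearMap.proj (R := ℝ) (φ := fun _ : Fin 4 => ℝ) 0).hasFDerivAt
  have h1 := hF.hasDerivAt.comp_hasFDerivAt x h0
  have h2 : fderiv ℝ (fun y : Coord => F (y 0)) x = _ := h1.fderiv
  simp only [partialDeriv, h2]
  by_cases ha : a = 0
  · subst ha; simp
  · simp [ha, Ne.symm ha]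

end PartialDeriv

/-! ### Integrability conditions for the conformal factor. -/

lemma partialDeriv_comm₃ {U : Set Coord} {f : Coord → ℝ} {x : Coord} (hU : IsOpen U)
    (hf : ContDiffOn ℝ ∞ f U) (hx : x ∈ U) (a b : Fin 4) :
    partialDeriv a (partialDeriv b (partialDeriv b f)) x
      = partialDeriv b (partialDeriv b (partialDeriv a f)) x := by
  rw [partialDeriv_comm hU (contDiffOn_partialDeriv hU hf b) hx,
    partialDeriv_congr hU (fun y hy => partialDeriv_comm hU hf hy a b) hx]

/-- A conformal vector field `(τ, ξ)` of a diagonal metric with `G₀₀ = -1`, `G_{μμ} = B_μ(t)`, whose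
conformal factor `φ` is compatible with the preservation of the curvature, has constant `φ`. -/
theorem partialDeriv_conformalFactor_eq_zero {U : Set Coord} (hU : IsOpen U)
    {τ φ : Coord → ℝ} {ξ B H : Fin 3 → Coord → ℝ}
    (hτ : ContDiffOn ℝ ∞ τ U) (hφ : ContDiffOn ℝ ∞ φ U) (hξ : ∀ μ, ContDiffOn ℝ ∞ (ξ μ) U)
    (hB : ∀ μ, ContDiffOn ℝ ∞ (B μ) U) (hH : ∀ μ, ContDiffOn ℝ ∞ (H μ) U)
    (hB0 : ∀ μ, ∀ y ∈ U, B μ y ≠ 0)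
    (hBt : ∀ μ, ∀ y ∈ U, partialDeriv 0 (B μ) y = 2 * (H μ y * B μ y))
    (hBs : ∀ μ ν, ∀ y ∈ U, partialDeriv (Fin.succ ν) (B μ) y = 0)
    (hHs : ∀ μ ν, ∀ y ∈ U, partialDeriv (Fin.succ ν) (H μ) y = 0)
    (hτt : ∀ y ∈ U, partialDeriv 0 τ y = φ y)
    (hξt : ∀ μ, ∀ y ∈ U, B μ y * partialDeriv 0 (ξ μ) y = partialDeriv (Fin.succ μ) τ y)
    (hξd : ∀ μ, ∀ y ∈ U, partialDeriv (Fin.succ μ) (ξ μ) y = φ y - τ y * H μ y)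
    (hξo : ∀ μ ν, μ ≠ ν → ∀ y ∈ U, B μ y * partialDeriv (Fin.succ ν) (ξ μ) y
      + B ν y * partialDeriv (Fin.succ μ) (ξ ν) y = 0)
    (hF : ∀ μ, ∀ y ∈ U, τ y * (partialDeriv 0 (partialDeriv 0 (H μ)) y
      + 2 * H μ y * partialDeriv 0 (H μ) y)
      + 2 * (partialDeriv 0 (H μ) y + H μ y * H μ y) * φ y = 0)
    (hHH : ∀ μ ν, μ ≠ ν → ∀ y ∈ U, τ y * (partialDeriv 0 (H μ) y * H ν y
      + H μ y * partialDeriv 0 (H ν) y) + 2 * (H μ y * H ν y) * φ y = 0)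
    (hFH : ∀ μ ν, μ ≠ ν → ∀ y ∈ U, (partialDeriv 0 (H ν) y + H ν y * H ν y - H μ y * H ν y)
      * partialDeriv (Fin.succ μ) τ y = 0)
    (hR0 : ∀ y ∈ U, ∃ μ, partialDeriv 0 (H μ) y + H μ y * H μ y ≠ 0)
    (hRs : ∀ μ, ∀ y ∈ U, partialDeriv 0 (H μ) y + H μ y * H μ y ≠ 0 ∨ H μ y ≠ 0) :
    ∀ y ∈ U, ∀ a, partialDeriv a φ y = 0 := by
  have pd := fun {f : Coord → ℝ} (hf : ContDiffOn ℝ ∞ f U) (a : Fin 4) =>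
    contDiffOn_partialDeriv hU hf a
  have hH1s : ∀ μ ν, ∀ y ∈ U, partialDeriv (Fin.succ ν) (partialDeriv 0 (H μ)) y = 0 := by
    intro μ ν y hy
    rw [partialDeriv_comm hU (hH μ) hy]
    exact partialDeriv_eq_zero_of_const hU (hHs μ ν) hy 0
  have hφt : ∀ a b, ∀ y ∈ U, partialDeriv a (partialDeriv b (partialDeriv 0 τ)) y
      = partialDeriv a (partialDeriv b φ) y := by
    intro a b y hy
    exact partialDeriv_congr hU (fun z hz => partialDeriv_congr hU hτt hz b) hy a
  have hτss : ∀ μ, ∀ y ∈ U, partialDeriv (Fin.succ μ) (partialDeriv (Fin.succ μ) τ) y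
      = B μ y * (partialDeriv 0 φ y - φ y * H μ y - τ y * partialDeriv 0 (H μ) y) := by
    intro μ y hy
    have h1 := partialDeriv_congr hU (hξt μ) hy (Fin.succ μ)
    have h2 := partialDeriv_congr hU (hξd μ) hy 0
    have := hB μ; have := hH μ; have := pd (hξ μ) 0
    simp (disch := first | assumption | fun_prop) only [partialDeriv_mul, partialDeriv_sub,
      hBs, hτt] at h1 h2
    rw [partialDeriv_comm hU (hξ μ) hy, h2] at h1
    linear_combination -h1
  -- Time derivative of `hτss`; the terms without derivatives of `φ` are exactly those cancelled by
  -- `hF`.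
  have hφss : ∀ μ, ∀ y ∈ U, partialDeriv (Fin.succ μ) (partialDeriv (Fin.succ μ) φ) y
      = B μ y * (partialDeriv 0 (partialDeriv 0 φ) y + H μ y * partialDeriv 0 φ y) := by
    intro μ y hy
    have h1 := partialDeriv_congr hU (hτss μ) hy 0
    have := hB μ; have := hH μ; have := pd hφ 0; have := pd (hH μ) 0
    rw [partialDeriv_comm₃ hU hτ hy, hφt _ _ y hy] at h1
    simp (disch := first | assumption | fun_prop) only [partialDeriv_mul, partialDeriv_sub,
      hBt, hτt] at h1
    linear_combination h1 - B μ y * hF μ y hy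
  have hτst : ∀ μ ν, μ ≠ ν → ∀ y ∈ U, partialDeriv (Fin.succ μ) (partialDeriv (Fin.succ ν) τ) y
      = (H μ y - H ν y) * (B ν y * partialDeriv (Fin.succ μ) (ξ ν) y) := by
    intro μ ν hμν y hy
    have h1 := partialDeriv_congr hU (hξo μ ν hμν) hy 0
    have h2 := partialDeriv_congr hU (hξt μ) hy (Fin.succ ν)
    have h3 := partialDeriv_congr hU (hξt ν) hy (Fin.succ μ)
    have := hB μ; have := hB ν
    have := pd (hξ μ) (Fin.succ ν); have := pd (hξ ν) (Fin.succ μ)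
    have := pd (hξ μ) 0; have := pd (hξ ν) 0
    rw [partialDeriv_const, partialDeriv_add hU (by fun_prop) (by fun_prop) hy] at h1
    simp (disch := first | assumption | fun_prop) only [partialDeriv_mul, hBt, hBs] at h1 h2 h3
    rw [partialDeriv_comm hU (hξ μ) hy] at h2
    rw [partialDeriv_comm hU (hξ ν) hy] at h3
    rw [partialDeriv_comm hU hτ hy] at h2
    linear_combination (-1/2) * h2 - 1/2 * h3 + 1/2 * h1 - H μ y * hξo μ ν hμν y hy
  have hφst : ∀ μ, ∀ y ∈ U, partialDeriv (Fin.succ μ) (partialDeriv 0 φ) y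
      = H μ y * partialDeriv (Fin.succ μ) φ y := by
    intro μ y hy
    -- An auxiliary second spatial direction: computing `∂μ∂ν∂ντ` in two ways leaves only a multiple
    -- of `(K₀ν - Kμν) ∂μτ`, which is zero by `hFH`.
    obtain ⟨ν, hν⟩ := exists_ne μ
    have h1 := partialDeriv_congr hU (hτst μ ν hν.symm) hy (Fin.succ ν)
    have h2 := partialDeriv_congr hU (hτss ν) hy (Fin.succ μ)
    have h3 := partialDeriv_congr hU (hξd ν) hy (Fin.succ μ)
    have := hB ν; have := hH μ; have := hH ν; have := pd hφ 0; have := pd (hH ν) 0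
    have := pd (hξ ν) (Fin.succ μ)
    simp (disch := first | assumption | fun_prop) only [partialDeriv_mul, partialDeriv_sub,
      hBs, hHs, hH1s] at h1 h2 h3
    rw [partialDeriv_comm hU (pd hτ _) hy, h2, partialDeriv_comm hU (hξ ν) hy, h3] at h1
    refine mul_left_cancel₀ (hB0 ν y hy) ?_
    linear_combination h1 + B ν y * hFH μ ν hν.symm y hy
  -- Compatibility of the strains in a spatial plane: eliminating `ξ` leaves `2φ'' + 2φHμHν +
  -- τ(HμHν)' = 0`, and `hHH` removes all but the first term.
  have hφtt : ∀ y ∈ U, partialDeriv 0 (partialDeriv 0 φ) y = 0 := by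
    intro y hy
    have h01 : (0 : Fin 3) ≠ 1 := by decide
    generalize (0 : Fin 3) = μ at h01
    generalize (1 : Fin 3) = ν at h01
    have := hB μ; have := hB ν; have := hH μ; have := hH ν
    have := pd (hξ μ) (Fin.succ ν); have := pd (hξ ν) (Fin.succ μ)
    have h1 : ∀ z ∈ U, B μ z * (partialDeriv (Fin.succ ν) φ z
        - partialDeriv (Fin.succ ν) τ z * H μ z)
        + B ν z * partialDeriv (Fin.succ μ) (partialDeriv (Fin.succ μ) (ξ ν)) z = 0 := by
      intro z hz
      have h1 := partialDeriv_congr hU (hξo μ ν h01) hz (Fin.succ μ)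
      have h2 := partialDeriv_congr hU (hξd μ) hz (Fin.succ ν)
      rw [partialDeriv_const, partialDeriv_add hU (by fun_prop) (by fun_prop) hz] at h1
      simp (disch := first | assumption | fun_prop) only [partialDeriv_mul, partialDeriv_sub,
        hBs, hHs] at h1 h2
      rw [partialDeriv_comm hU (hξ μ) hz, h2] at h1
      linear_combination h1
    have h2 : ∀ z ∈ U, partialDeriv (Fin.succ μ) (partialDeriv (Fin.succ ν) (ξ ν)) z
        = partialDeriv (Fin.succ μ) φ z - partialDeriv (Fin.succ μ) τ z * H ν z := by
      intro z hz
      have h2 := partialDeriv_congr hU (hξd ν) hz (Fin.succ μ)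
      simp (disch := first | assumption | fun_prop) only [partialDeriv_mul, partialDeriv_sub,
        hHs] at h2
      linear_combination h2
    have h3 := partialDeriv_congr hU h1 hy (Fin.succ ν)
    have h4 := partialDeriv_congr hU h2 hy (Fin.succ μ)
    have := pd hφ (Fin.succ ν); have := pd hφ (Fin.succ μ)
    have := pd hτ (Fin.succ ν); have := pd hτ (Fin.succ μ)
    have := pd (pd (hξ ν) (Fin.succ μ)) (Fin.succ μ)
    rw [partialDeriv_const, partialDeriv_add hU (by fun_prop) (by fun_prop) hy] at h3
    simp (disch := first | assumption | fun_prop) only [partialDeriv_mul, partialDeriv_sub,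
      hBs, hHs] at h3 h4
    rw [partialDeriv_comm₃ hU (hξ ν) hy, h4, hφss ν y hy, hφss μ y hy, hτss ν y hy,
      hτss μ y hy] at h3
    have h5 := mul_ne_zero (hB0 μ y hy) (hB0 ν y hy)
    refine mul_left_cancel₀ h5 ?_
    linear_combination 1/2 * h3 - 1/2 * B μ y * B ν y * hHH μ ν h01 y hy
  -- Both expressions for `∂ₜ∂μ∂μφ`, from `hφss` and from `hφst`, are multiples of `φ'`; their
  -- difference is `Bμ(Hμ' + Hμ²)φ'`.
  have hφ0 : ∀ y ∈ U, partialDeriv 0 φ y = 0 := by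
    intro y hy
    obtain ⟨μ, hμ⟩ := hR0 y hy
    have h1 := partialDeriv_congr hU (hφss μ) hy 0
    have h2 := partialDeriv_congr hU (hφst μ) hy (Fin.succ μ)
    have := hB μ; have := hH μ; have := pd hφ 0; have := pd (pd hφ 0) 0
    have := pd hφ (Fin.succ μ)
    rw [partialDeriv_comm₃ hU hφ hy, h2, partialDeriv_mul hU (by fun_prop) (by fun_prop) hy,
      partialDeriv_mul hU (by fun_prop) (by fun_prop) hy,
      partialDeriv_add hU (by fun_prop) (by fun_prop) hy,
      partialDeriv_mul hU (by fun_prop) (by fun_prop) hy, hφtt y hy, hφss μ y hy,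
      partialDeriv_eq_zero_of_const hU hφtt hy, hHs μ μ y hy, hBt μ y hy, hφtt y hy] at h1
    refine mul_left_cancel₀ (mul_ne_zero (hB0 μ y hy) hμ) ?_
    linear_combination -h1
  intro y hy a
  refine Fin.cases (hφ0 y hy) (fun μ => ?_) a
  have h1 : ∀ z ∈ U, H μ z * partialDeriv (Fin.succ μ) φ z = 0 := fun z hz => by
    rw [← hφst μ z hz, partialDeriv_eq_zero_of_const hU hφ0 hz]
  -- At a zero of `Hμ` the relation `Hμ ∂μφ = 0` is differentiated in time, and `hRs` gives `Hμ' ≠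
  -- 0` there.
  by_cases h0 : H μ y = 0
  · have h2 := partialDeriv_eq_zero_of_const hU h1 hy 0
    rw [partialDeriv_mul hU (hH μ) (pd hφ _) hy, h0, zero_mul, add_zero] at h2
    have h3 := hRs μ y hy
    simp only [h0, mul_zero, add_zero, ne_eq, not_true_eq_false, or_false] at h3
    exact (mul_eq_zero.mp h2).resolve_left h3
  · exact (mul_eq_zero.mp (h1 y hy)).resolve_left h0

/-! ### Curvature of the diagonal metric. -/

/-- The diagonal entries of `metric A`. -/
def metricDiag (A : Fin 3 → ℝ → ℝ) (a : Fin 4) (x : Coord) : ℝ :=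
  (Fin.cons (-1) fun μ => A μ (x 0) ^ 2 : Fin 4 → ℝ) a

/-- The Hubble rates `A_μ' / A_μ`, extended by `0` in the time direction. -/
def hubble (A : Fin 3 → ℝ → ℝ) (a : Fin 4) (x : Coord) : ℝ :=
  (Fin.cons 0 fun μ => deriv (A μ) (x 0) / A μ (x 0) : Fin 4 → ℝ) a

/-- The sectional curvatures of the coordinate planes of `metric A`. -/
def sectional (A : Fin 3 → ℝ → ℝ) (a b : Fin 4) (x : Coord) : ℝ :=
  if a = b then 0
  else if a = 0 then partialDeriv 0 (hubble A b) x + hubble A b x * hubble A b x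
  else if b = 0 then partialDeriv 0 (hubble A a) x + hubble A a x * hubble A a x
  else hubble A a x * hubble A b x

variable {I : Set ℝ} {A : Fin 3 → ℝ → ℝ} {x : Coord}

lemma metric_apply (a b : Fin 4) (x : Coord) :
    metric A x a b = if a = b then metricDiag A a x else 0 := by
  simp [metric, metricDiag, Matrix.diagonal_apply]

lemma isOpen_manifold (hI : IsOpen I) : IsOpen (manifold I) :=
  hI.preimage (continuous_apply 0)

lemma contDiffOn_time {F : ℝ → ℝ} (hF : ContDiffOn ℝ ∞ F I) :
    ContDiffOn ℝ ∞ (fun x : Coord => F (x 0)) (manifold I) :=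
  hF.comp (contDiff_apply ℝ ℝ (0 : Fin 4)).contDiffOn fun _ h => h

namespace IsProperSpacetime

lemma contDiffOn_metricDiag (hA : IsProperSpacetime I A) (a : Fin 4) : ContDiffOn ℝ ∞ (metricDiag A a) (manifold I) := by
  refine Fin.cases ?_ (fun μ => ?_) a
  · exact contDiffOn_const
  · exact (contDiffOn_time (hA.smooth μ)).pow 2

lemma contDiffOn_hubble (hA : IsProperSpacetime I A) (a : Fin 4) : ContDiffOn ℝ ∞ (hubble A a) (manifold I) := by
  refine Fin.cases ?_ (fun μ => ?_) a
  · exact contDiffOn_const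
  · exact contDiffOn_time (F := fun t => deriv (A μ) t / A μ t)
      (((hA.smooth μ).deriv_of_isOpen hA.isOpen (by simp)).div (hA.smooth μ) (hA.ne_zero μ))

lemma metricDiag_ne_zero (hA : IsProperSpacetime I A) (hx : x ∈ manifold I) (a : Fin 4) : metricDiag A a x ≠ 0 := by
  refine Fin.cases ?_ (fun μ => ?_) a
  · simp [metricDiag]
  · simpa [metricDiag] using hA.ne_zero μ _ hx

/-- The zero value of the Hubble rate in the time direction lets one formula cover `g₀₀ = -1` as
well. -/
lemma partialDeriv_metricDiag (hA : IsProperSpacetime I A) (hx : x ∈ manifold I) (a b : Fin 4) :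
    partialDeriv b (metricDiag A a) x
      = if b = 0 then 2 * (hubble A a x * metricDiag A a x) else 0 := by
  refine Fin.cases ?_ (fun μ => ?_) a
  · change partialDeriv b (fun _ => -1) x = _
    simp [hubble]
  · have hd : DifferentiableAt ℝ (A μ) (x 0) :=
      ((hA.smooth μ).contDiffAt (hA.isOpen.mem_nhds hx)).differentiableAt (by simp)
    have h0 := hA.ne_zero μ _ hx
    change partialDeriv b (fun y => (fun t => A μ t ^ 2) (y 0)) x = _
    rw [partialDeriv_time (F := fun t => A μ t ^ 2) (hd.pow 2), deriv_fun_pow hd]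
    simp only [hubble, metricDiag, Fin.cons_succ]
    split_ifs
    · field_simp
      norm_num
      ring
    · rfl

lemma partialDeriv_hubble (hA : IsProperSpacetime I A) (hx : x ∈ manifold I) (a b : Fin 4) :
    partialDeriv b (hubble A a) x = if b = 0 then partialDeriv 0 (hubble A a) x else 0 := by
  refine Fin.cases ?_ (fun μ => ?_) a
  · change partialDeriv b (fun _ => 0) x = if b = 0 then partialDeriv 0 (fun _ => 0) x else 0
    simp
  · have hd : DifferentiableAt ℝ (fun t => deriv (A μ) t / A μ t) (x 0) :=
      ((((hA.smooth μ).deriv_of_isOpen (m := ∞) hA.isOpen (by simp)).div (hA.smooth μ)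
        (hA.ne_zero μ)).contDiffAt (hA.isOpen.mem_nhds hx)).differentiableAt (by simp)
    change partialDeriv b (fun y => (fun t => deriv (A μ) t / A μ t) (y 0)) x
      = if b = 0 then partialDeriv 0 (fun y => (fun t => deriv (A μ) t / A μ t) (y 0)) x else 0
    rw [partialDeriv_time hd, partialDeriv_time hd]
    simp

lemma partialDeriv_metric (hA : IsProperSpacetime I A) (hx : x ∈ manifold I) (a b c : Fin 4) :
    partialDeriv c (fun y => metric A y a b) x
      = if a = b ∧ c = 0 then 2 * (hubble A a x * metricDiag A a x) else 0 := by
  simp only [metric_apply]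
  by_cases hab : a = b
  · simpa [hab] using hA.partialDeriv_metricDiag hx b c
  · simp [hab]

lemma metric_inv (hA : IsProperSpacetime I A) (hx : x ∈ manifold I) (a b : Fin 4) :
    (metric A x)⁻¹ a b = if a = b then (metricDiag A a x)⁻¹ else 0 := by
  have : (metric A x)⁻¹ = Matrix.diagonal fun a => (metricDiag A a x)⁻¹ := by
    refine Matrix.inv_eq_right_inv ?_
    change Matrix.diagonal (fun a => metricDiag A a x) * _ = _
    rw [Matrix.diagonal_mul_diagonal, ← Matrix.diagonal_one]
    congr 1
    funext a
    exact mul_inv_cancel₀ (hA.metricDiag_ne_zero hx a)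
  rw [this, Matrix.diagonal_apply]

lemma christoffel_eq (hA : IsProperSpacetime I A) (hx : x ∈ manifold I) (a b c : Fin 4) :
    christoffel (metric A) a b c x
      = (if b = 0 ∧ a = c then hubble A a x else 0) + (if c = 0 ∧ a = b then hubble A a x else 0)
        + (if a = 0 ∧ b = c then hubble A b x * metricDiag A b x else 0) := by
  have h0 := hA.metricDiag_ne_zero hx a
  have h00 : metricDiag A 0 x = -1 := rfl
  have hh0 : hubble A 0 x = 0 := rfl
  simp only [christoffel, hA.metric_inv hx, hA.partialDeriv_metric hx, ite_mul, zero_mul,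
    Finset.sum_ite_eq, Finset.mem_univ, if_true]
  by_cases ha : a = 0
  · subst ha
    rw [h00, hh0]
    by_cases hbc : b = c <;> simp [hbc]
  · by_cases hab : a = b <;> by_cases hac : a = c <;> by_cases hb : b = 0 <;>
      by_cases hc : c = 0 <;> simp_all <;> field_simp

lemma partialDeriv_christoffel (hA : IsProperSpacetime I A) (hx : x ∈ manifold I)
    (a b c d : Fin 4) :
    partialDeriv d (christoffel (metric A) a b c) x
      = if d = 0 then (if b = 0 ∧ a = c then partialDeriv 0 (hubble A a) x else 0)
        + (if c = 0 ∧ a = b then partialDeriv 0 (hubble A a) x else 0)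
        + (if a = 0 ∧ b = c then (partialDeriv 0 (hubble A b) x
          + 2 * hubble A b x * hubble A b x) * metricDiag A b x else 0) else 0 := by
  have hU := isOpen_manifold hA.isOpen
  have ite_smooth : ∀ (p : Prop) [Decidable p] (f : Coord → ℝ),
      ContDiffOn ℝ ∞ f (manifold I) → ContDiffOn ℝ ∞ (fun y => if p then f y else 0)
      (manifold I) := by
    intro p _ f hf
    split_ifs
    · exact hf
    · exact contDiffOn_const
  have ite_pd : ∀ (p : Prop) [Decidable p] (f : Coord → ℝ),
      partialDeriv d (fun y => if p then f y else 0) x = if p then partialDeriv d f x else 0 := by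
    intro p _ f
    split_ifs
    · rfl
    · simp
  have h1 := hA.contDiffOn_hubble
  have h2 := hA.contDiffOn_metricDiag
  rw [partialDeriv_congr hU (fun y hy => hA.christoffel_eq hy a b c) hx,
    partialDeriv_add hU ((ite_smooth _ _ (h1 a)).add (ite_smooth _ _ (h1 a)))
      (ite_smooth _ _ ((h1 b).mul (h2 b))) hx,
    partialDeriv_add hU (ite_smooth _ _ (h1 a)) (ite_smooth _ _ (h1 a)) hx,
    ite_pd, ite_pd, ite_pd, partialDeriv_mul hU (h1 b) (h2 b) hx, hA.partialDeriv_hubble hx a,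
    hA.partialDeriv_hubble hx b, hA.partialDeriv_metricDiag hx b]
  by_cases hd : d = 0
  · simp only [hd, if_true]
    congr 2
    ring
  · simp [hd]

/-- The reflections `xμ ↦ -xμ` are isometries, so each index must occur an even number of times. The
proof checks all components. -/
lemma riemann_eq (hA : IsProperSpacetime I A) (hx : x ∈ manifold I) (a b c d : Fin 4) :
    riemann (metric A) a b c d x = sectional A c d x *
      ((if a = c ∧ b = d then metricDiag A b x else 0)
        - (if a = d ∧ b = c then metricDiag A b x else 0)) := by
  have h00 : metricDiag A 0 x = -1 := rfl
  have hh0 : hubble A 0 x = 0 := rfl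
  simp only [riemann, hA.partialDeriv_christoffel hx, hA.christoffel_eq hx, sectional,
    Fin.sum_univ_four]
  fin_cases a <;> fin_cases b <;> fin_cases c <;> fin_cases d <;> simp [h00, hh0] <;> ring

end IsProperSpacetime

@[simp] lemma sectional_self (A : Fin 3 → ℝ → ℝ) (a : Fin 4) (x : Coord) :
    sectional A a a x = 0 := by simp [sectional]

lemma sectional_comm (A : Fin 3 → ℝ → ℝ) (a b : Fin 4) : sectional A a b = sectional A b a := by
  funext x
  simp only [sectional]
  split_ifs <;> simp_all [mul_comm]

lemma sectional_zero_succ (A : Fin 3 → ℝ → ℝ) (μ : Fin 3) :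
    sectional A 0 μ.succ = fun x => partialDeriv 0 (hubble A μ.succ) x
      + hubble A μ.succ x * hubble A μ.succ x := by
  funext x
  simp [sectional, (Fin.succ_ne_zero μ).symm]

lemma sectional_succ_succ (A : Fin 3 → ℝ → ℝ) {μ ν : Fin 3} (h : μ ≠ ν) :
    sectional A μ.succ ν.succ = fun x => hubble A μ.succ x * hubble A ν.succ x := by
  funext x
  simp [sectional, h]

namespace IsProperSpacetime

lemma partialDeriv_zero_hubble (hA : IsProperSpacetime I A) (hx : x ∈ manifold I) (a b : Fin 4)
    (hb : b ≠ 0) : partialDeriv b (partialDeriv 0 (hubble A a)) x = 0 := by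
  rw [partialDeriv_comm (isOpen_manifold hA.isOpen) (hA.contDiffOn_hubble a) hx]
  exact partialDeriv_eq_zero_of_const (isOpen_manifold hA.isOpen)
    (fun y hy => by rw [hA.partialDeriv_hubble hy, if_neg hb]) hx 0

lemma contDiffOn_sectional (hA : IsProperSpacetime I A) (a b : Fin 4) :
    ContDiffOn ℝ ∞ (sectional A a b) (manifold I) := by
  have h := hA.contDiffOn_hubble
  have h' := fun c => contDiffOn_partialDeriv (isOpen_manifold hA.isOpen) (h c) 0
  unfold sectional
  split_ifs
  · exact contDiffOn_const
  · exact (h' b).add ((h b).mul (h b))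
  · exact (h' a).add ((h a).mul (h a))
  · exact (h a).mul (h b)

lemma partialDeriv_sectional_zero_succ (hA : IsProperSpacetime I A) (hx : x ∈ manifold I)
    (μ : Fin 3) (c : Fin 4) : partialDeriv c (sectional A 0 μ.succ) x
      = partialDeriv c (partialDeriv 0 (hubble A μ.succ)) x
        + 2 * hubble A μ.succ x * partialDeriv c (hubble A μ.succ) x := by
  have hU := isOpen_manifold hA.isOpen
  have h := hA.contDiffOn_hubble μ.succ
  rw [sectional_zero_succ, partialDeriv_add hU (contDiffOn_partialDeriv hU h 0) (h.mul h) hx,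
    partialDeriv_mul hU h h hx]
  ring

lemma partialDeriv_sectional_succ_succ (hA : IsProperSpacetime I A) (hx : x ∈ manifold I)
    {μ ν : Fin 3} (hμν : μ ≠ ν) (c : Fin 4) : partialDeriv c (sectional A μ.succ ν.succ) x
      = partialDeriv c (hubble A μ.succ) x * hubble A ν.succ x
        + hubble A μ.succ x * partialDeriv c (hubble A ν.succ) x := by
  rw [sectional_succ_succ A hμν, partialDeriv_mul (isOpen_manifold hA.isOpen)
    (hA.contDiffOn_hubble _) (hA.contDiffOn_hubble _) hx]

lemma partialDeriv_sectional (hA : IsProperSpacetime I A) (hx : x ∈ manifold I) (a b c : Fin 4) :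
    partialDeriv c (sectional A a b) x
      = if c = 0 then partialDeriv 0 (sectional A a b) x else 0 := by
  have h0 : ∀ μ : Fin 3, ∀ c : Fin 4, c ≠ 0 → partialDeriv c (sectional A 0 μ.succ) x = 0 := by
    intro μ c hc
    rw [hA.partialDeriv_sectional_zero_succ hx, hA.partialDeriv_zero_hubble hx _ _ hc,
      hA.partialDeriv_hubble hx, if_neg hc]
    simp
  by_cases hc : c = 0
  · simp [hc]
  rw [if_neg hc]
  by_cases hab : a = b
  · subst hab
    exact partialDeriv_eq_zero_of_const (isOpen_manifold hA.isOpen)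
      (fun y _ => sectional_self A a y) hx c
  induction a using Fin.cases with
  | zero =>
    induction b using Fin.cases with
    | zero => exact absurd rfl hab
    | succ ν => exact h0 ν c hc
  | succ μ =>
    induction b using Fin.cases with
    | zero => rw [sectional_comm]; exact h0 μ c hc
    | succ ν =>
      rw [hA.partialDeriv_sectional_succ_succ hx fun h => hab (congrArg _ h),
        hA.partialDeriv_hubble hx, hA.partialDeriv_hubble hx ν.succ, if_neg hc, if_neg hc]
      simp

lemma partialDeriv_riemann (hA : IsProperSpacetime I A) (hx : x ∈ manifold I)
    (a b c d e : Fin 4) : partialDeriv e (riemann (metric A) a b c d) x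
      = if e = 0 then (partialDeriv 0 (sectional A c d) x + 2 * hubble A b x * sectional A c d x) *
      ((if a = c ∧ b = d then metricDiag A b x else 0)
        - (if a = d ∧ b = c then metricDiag A b x else 0)) else 0 := by
  have hU := isOpen_manifold hA.isOpen
  have h : ∀ y ∈ manifold I, riemann (metric A) a b c d y = (sectional A c d y * metricDiag A b y)
      * ((if a = c ∧ b = d then 1 else 0) - (if a = d ∧ b = c then 1 else 0)) := by
    intro y hy
    rw [hA.riemann_eq hy]
    split_ifs <;> ring
  have hK := hA.contDiffOn_sectional c d
  have hG := hA.contDiffOn_metricDiag b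
  rw [partialDeriv_congr hU h hx, partialDeriv_mul hU (hK.mul hG) contDiffOn_const hx,
    partialDeriv_mul hU hK hG hx, partialDeriv_const, hA.partialDeriv_sectional hx,
    hA.partialDeriv_metricDiag hx]
  split_ifs <;> ring

lemma lieMetric_eq (hA : IsProperSpacetime I A) (hx : x ∈ manifold I) (X : VectorField)
    (a b : Fin 4) : lieMetric X (metric A) a b x
      = (if a = b then 2 * X x 0 * hubble A a x * metricDiag A a x else 0)
        + metricDiag A b x * partialDeriv a (fun y => X y b) x
        + metricDiag A a x * partialDeriv b (fun y => X y a) x := by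
  simp only [lieMetric, hA.partialDeriv_metric hx, Finset.sum_add_distrib]
  simp only [metric_apply, ite_mul, zero_mul, Finset.sum_ite_eq, Finset.sum_ite_eq',
    Finset.mem_univ, if_true]
  congr 2
  by_cases hab : a = b
  · simp [hab]
    ring
  · simp [hab]

lemma ricci_eq (hA : IsProperSpacetime I A) (hx : x ∈ manifold I) (b d : Fin 4) :
    ricci (metric A) x b d
      = if b = d then metricDiag A b x * ∑ a, sectional A a b x else 0 := by
  simp only [ricci, Matrix.of_apply, hA.riemann_eq hx]
  by_cases hbd : b = d
  · subst hbd
    simp only [and_true, if_true, Finset.mul_sum]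
    refine Finset.sum_congr rfl fun a _ => ?_
    by_cases hab : a = b
    · simp [hab]
    · simp [hab, mul_comm]
  · simp only [hbd, and_false, if_false, zero_sub]
    refine Finset.sum_eq_zero fun a _ => ?_
    rw [if_neg fun h => hbd (h.2.trans h.1), neg_zero, mul_zero]

/-- Otherwise a row of the diagonal Ricci matrix vanishes. Non-degeneracy enters the proof only
through this lemma. -/
lemma exists_sectional_ne_zero (hA : IsProperSpacetime I A) (hx : x ∈ manifold I)
    (hdet : (ricci (metric A) x).det ≠ 0) (b : Fin 4) : ∃ a, a ≠ b ∧ sectional A a b x ≠ 0 := by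
  by_contra! h
  refine hdet (Matrix.det_eq_zero_of_row_eq_zero b fun d => ?_)
  rw [hA.ricci_eq hx, Finset.sum_eq_zero fun a _ => ?_, mul_zero, ite_self]
  by_cases hab : a = b
  · rw [hab, sectional_self]
  · exact h a hab

/-! ### Components of the Lie derivative of the curvature. -/

section LieRiemann

variable {X : VectorField}

lemma lieRiemann_abab (hA : IsProperSpacetime I A) (hx : x ∈ manifold I) {a b : Fin 4}
    (hab : a ≠ b) : lieRiemann X (metric A) a b a b x = metricDiag A b x *
      (X x 0 * partialDeriv 0 (sectional A a b) x + 2 * sectional A a b x *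
        (X x 0 * hubble A b x + partialDeriv b (fun y => X y b) x)) := by
  simp only [lieRiemann, hA.partialDeriv_riemann hx, hA.riemann_eq hx, Fin.sum_univ_four]
  fin_cases a <;> fin_cases b <;> first | exact absurd rfl hab | (simp; ring)

lemma lieRiemann_abcb (hA : IsProperSpacetime I A) (hx : x ∈ manifold I) {a b c : Fin 4}
    (hab : a ≠ b) (hac : a ≠ c) (hbc : b ≠ c) : lieRiemann X (metric A) a b c b x
      = metricDiag A b x * ((sectional A a b x - sectional A c b x)
        * partialDeriv c (fun y => X y a) x) := by
  simp only [lieRiemann, hA.partialDeriv_riemann hx, hA.riemann_eq hx, Fin.sum_univ_four]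
  fin_cases a <;> fin_cases b <;> first | exact absurd rfl hab | (fin_cases c <;>
    first | exact absurd rfl hac | exact absurd rfl hbc | (simp; ring))

lemma lieRiemann_abad (hA : IsProperSpacetime I A) (hx : x ∈ manifold I) {a b d : Fin 4}
    (hab : a ≠ b) (had : a ≠ d) (hbd : b ≠ d) : lieRiemann X (metric A) a b a d x
      = sectional A a d x * (metricDiag A d x * partialDeriv b (fun y => X y d) x)
        + sectional A a b x * (metricDiag A b x * partialDeriv d (fun y => X y b) x) := by
  simp only [lieRiemann, hA.partialDeriv_riemann hx, hA.riemann_eq hx, Fin.sum_univ_four]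
  fin_cases a <;> fin_cases b <;> first | exact absurd rfl hab | (fin_cases d <;>
    first | exact absurd rfl had | exact absurd rfl hbd | (simp; ring))

/-- The component `Rᵃ_{aab}` itself vanishes, but its Lie derivative still detects the off-diagonal
strain. -/
lemma lieRiemann_aaab (hA : IsProperSpacetime I A) (hx : x ∈ manifold I) {a b : Fin 4}
    (hab : a ≠ b) : lieRiemann X (metric A) a a a b x = sectional A a b x *
      (metricDiag A a x * partialDeriv b (fun y => X y a) x
        + metricDiag A b x * partialDeriv a (fun y => X y b) x) := by
  simp only [lieRiemann, hA.partialDeriv_riemann hx, hA.riemann_eq hx, Fin.sum_univ_four]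
  fin_cases a <;> fin_cases b <;> first | exact absurd rfl hab | (simp; ring)

end LieRiemann

end IsProperSpacetime

/-! ### Curvature collineations are conformal, then homothetic. -/

/-- Half the diagonal component of `L_X g` relative to `g`:
`(L_X g)_{aa} = 2 (strain X a) g_{aa}`. -/
def strain (A : Fin 3 → ℝ → ℝ) (X : VectorField) (a : Fin 4) (x : Coord) : ℝ :=
  X x 0 * hubble A a x + partialDeriv a (fun y => X y a) x

variable {U : Set Coord} {X : VectorField}

namespace IsProperSpacetime

lemma sectional_mul_strain (hA : IsProperSpacetime I A) (hx : x ∈ manifold I)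
    (hX : ∀ a b c d, lieRiemann X (metric A) a b c d x = 0) {a b : Fin 4} (hab : a ≠ b) :
    X x 0 * partialDeriv 0 (sectional A a b) x + 2 * sectional A a b x * strain A X b x = 0 := by
  have h := hA.lieRiemann_abab (X := X) hx hab
  rw [hX] at h
  exact (mul_eq_zero.mp h.symm).resolve_left (hA.metricDiag_ne_zero hx b)

/-- Since `K` is symmetric, exchanging `a` and `b` in `sectional_mul_strain` and subtracting cancels
the derivative of `K`. -/
lemma sectional_mul_strain_sub (hA : IsProperSpacetime I A) (hx : x ∈ manifold I)
    (hX : ∀ a b c d, lieRiemann X (metric A) a b c d x = 0) (a b : Fin 4) :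
    sectional A a b x * (strain A X a x - strain A X b x) = 0 := by
  by_cases hab : a = b
  · rw [hab, sub_self, mul_zero]
  have h1 := hA.sectional_mul_strain hx hX hab
  have h2 := hA.sectional_mul_strain hx hX (Ne.symm hab)
  rw [sectional_comm A b a] at h2
  linear_combination (h2 - h1) / 2

lemma sectional_sub_mul (hA : IsProperSpacetime I A) (hx : x ∈ manifold I)
    (hX : ∀ a b c d, lieRiemann X (metric A) a b c d x = 0) {a b c : Fin 4}
    (hab : a ≠ b) (hac : a ≠ c) (hbc : b ≠ c) :
    (sectional A a b x - sectional A c b x) * partialDeriv c (fun y => X y a) x = 0 := by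
  have h := hA.lieRiemann_abcb (X := X) hx hab hac hbc
  rw [hX] at h
  exact (mul_eq_zero.mp h.symm).resolve_left (hA.metricDiag_ne_zero hx b)

lemma shear_eq_zero (hA : IsProperSpacetime I A) (hx : x ∈ manifold I)
    (hdet : (ricci (metric A) x).det ≠ 0)
    (hX : ∀ a b c d, lieRiemann X (metric A) a b c d x = 0) {a b : Fin 4} (hab : a ≠ b) :
    metricDiag A b x * partialDeriv a (fun y => X y b) x
      + metricDiag A a x * partialDeriv b (fun y => X y a) x = 0 := by
  obtain ⟨c, hca, hK⟩ := hA.exists_sectional_ne_zero hx hdet a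
  refine (mul_eq_zero.mp ?_).resolve_left hK
  by_cases hcb : c = b
  · subst hcb
    have h := hA.lieRiemann_aaab (X := X) hx hab
    rw [hX] at h
    rw [sectional_comm]
    linear_combination -h
  -- With `c` a third direction, `h1` is the strain weighted by `K_cb` and `K_ca`; `h2` allows the
  -- first weight to be replaced by the second, which is nonzero.
  · have h1 := hA.lieRiemann_abad (X := X) hx hca hcb hab
    have h2 := hA.sectional_sub_mul hx hX (Ne.symm hcb) (Ne.symm hab) hca
    rw [hX] at h1
    rw [sectional_comm A b c, sectional_comm A a c] at h2
    linear_combination -h1 - metricDiag A b x * h2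

lemma contDiffOn_strain (hA : IsProperSpacetime I A) (hUo : IsOpen U) (hU : U ⊆ manifold I)
    (hX : ContDiffOn ℝ ∞ X U) (a : Fin 4) : ContDiffOn ℝ ∞ (strain A X a) U :=
  ((contDiffOn_pi.mp hX 0).mul ((hA.contDiffOn_hubble a).mono hU)).add
    (contDiffOn_partialDeriv hUo (contDiffOn_pi.mp hX a) a)

lemma strain_eq (hA : IsProperSpacetime I A) (hUo : IsOpen U) (hU : U ⊆ manifold I)
    (hX : IsSmoothCC (metric A) U X) (hx : x ∈ U) (hdet : (ricci (metric A) x).det ≠ 0)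
    (a : Fin 4) : strain A X a x = strain A X 0 x := by
  have hstrain : ∀ {a b}, sectional A a b x ≠ 0 → strain A X a x = strain A X b x :=
    fun {a b} h => sub_eq_zero.mp
      ((mul_eq_zero.mp (hA.sectional_mul_strain_sub (hU hx) (hX.2 x hx) a b)).resolve_left h)
  -- If `Hμ = 0`, all spatial planes through direction `μ` are flat, so the nonzero curvature must
  -- be `K₀μ = Hμ'`.
  have hzero : ∀ μ : Fin 3, hubble A μ.succ x = 0 →
      partialDeriv 0 (hubble A μ.succ) x ≠ 0 ∧ strain A X μ.succ x = strain A X 0 x := by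
    intro μ hμ
    obtain ⟨c, hc, hK⟩ := hA.exists_sectional_ne_zero (hU hx) hdet μ.succ
    induction c using Fin.cases with
    | zero =>
      refine ⟨fun h => hK ?_, (hstrain hK).symm⟩
      simp only [sectional_zero_succ, h, hμ, mul_zero, add_zero]
    | succ ν =>
      refine absurd ?_ hK
      simp only [sectional_succ_succ A fun h => hc (congrArg _ h), hμ, mul_zero]
  induction a using Fin.cases with
  | zero => rfl
  | succ ν =>
  by_cases hν : hubble A ν.succ x = 0
  · exact (hzero ν hν).2
  by_cases hall : ∃ μ : Fin 3, hubble A μ.succ x = 0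
  · obtain ⟨μ, hμ⟩ := hall
    have hμν : μ ≠ ν := fun h => hν (h ▸ hμ)
    have hs := hA.contDiffOn_strain hUo hU hX.1
    -- Here `Kμν = HμHν` vanishes at the point, but its time derivative `Hμ'Hν` does not, so
    -- differentiating `Kμν(sμ - sν) = 0` still yields `sμ = sν`.
    have h := partialDeriv_eq_zero_of_const hUo (fun y hy =>
      hA.sectional_mul_strain_sub (hU hy) (hX.2 y hy) μ.succ ν.succ) hx 0
    rw [partialDeriv_mul hUo ((hA.contDiffOn_sectional _ _).mono hU) ((hs _).sub (hs _)) hx,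
      hA.partialDeriv_sectional_succ_succ (hU hx) hμν, sectional_succ_succ A hμν] at h
    simp only [hμ, zero_mul, add_zero] at h
    rw [← (hzero μ hμ).2]
    exact (sub_eq_zero.mp ((mul_eq_zero.mp h).resolve_left
      (mul_ne_zero (hzero μ hμ).1 hν))).symm
  -- All spatial planes are now curved, so the spatial strains agree, and one nonzero `K₀μ` links
  -- them to the time direction.
  · push Not at hall
    obtain ⟨c, hc, hK⟩ := hA.exists_sectional_ne_zero (hU hx) hdet 0
    obtain ⟨μ, rfl⟩ := Fin.exists_succ_eq.mpr hc
    rw [← hstrain hK]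
    by_cases hμν : ν = μ
    · rw [hμν]
    · refine hstrain ?_
      rw [sectional_succ_succ A hμν]
      exact mul_ne_zero (hall ν) (hall μ)

theorem isSmoothHVF_of_isSmoothCC (hA : IsProperSpacetime I A)
    (hRic : ∀ x ∈ manifold I, (ricci (metric A) x).det ≠ 0) (hUo : IsOpen U)
    (hUc : IsPreconnected U) (hU : U ⊆ manifold I) (hX : IsSmoothCC (metric A) U X) :
    IsSmoothHVF (metric A) U X := by
  have hXa : ∀ a, ContDiffOn ℝ ∞ (fun y => X y a) U := contDiffOn_pi.mp hX.1
  have hs : ∀ x ∈ U, ∀ a, strain A X a x = partialDeriv 0 (fun y => X y 0) x := by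
    intro x hx a
    rw [hA.strain_eq hUo hU hX hx (hRic x (hU hx)) a]
    simp [strain, hubble]
  have hne : ∀ {μ ν : Fin 3}, μ ≠ ν → Fin.succ μ ≠ Fin.succ ν :=
    fun h h' => h (Fin.succ_injective _ h')
  have hψ : ∀ y ∈ U, ∀ a, partialDeriv a (partialDeriv 0 fun y => X y 0) y = 0 := by
    refine partialDeriv_conformalFactor_eq_zero hUo (τ := fun y => X y 0)
      (ξ := fun μ y => X y μ.succ) (B := fun μ => metricDiag A μ.succ)
      (H := fun μ => hubble A μ.succ) (hXa 0) (contDiffOn_partialDeriv hUo (hXa 0) 0)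
      (fun μ => hXa _) (fun μ => (hA.contDiffOn_metricDiag _).mono hU)
      (fun μ => (hA.contDiffOn_hubble _).mono hU)
      (fun μ y hy => hA.metricDiag_ne_zero (hU hy) _) ?_ ?_ ?_ (fun _ _ => rfl) ?_ ?_ ?_ ?_ ?_ ?_
      ?_ ?_
    · intro μ y hy
      rw [hA.partialDeriv_metricDiag (hU hy), if_pos rfl]
    · intro μ ν y hy
      rw [hA.partialDeriv_metricDiag (hU hy), if_neg (Fin.succ_ne_zero ν)]
    · intro μ ν y hy
      rw [hA.partialDeriv_hubble (hU hy), if_neg (Fin.succ_ne_zero ν)]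
    · intro μ y hy
      have h := hA.shear_eq_zero (hU hy) (hRic y (hU hy)) (hX.2 y hy) (Fin.succ_ne_zero μ).symm
      have h0 : metricDiag A 0 y = -1 := rfl
      rw [h0] at h
      linear_combination h
    · intro μ y hy
      rw [← hs y hy μ.succ, strain]
      ring
    · intro μ ν h y hy
      exact hA.shear_eq_zero (hU hy) (hRic y (hU hy)) (hX.2 y hy) (hne h).symm
    · intro μ y hy
      have h := hA.sectional_mul_strain (hU hy) (hX.2 y hy) (Fin.succ_ne_zero μ).symm
      rw [hA.partialDeriv_sectional_zero_succ (hU hy), hs y hy, sectional_zero_succ] at h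
      exact h
    · intro μ ν hμν y hy
      have h := hA.sectional_mul_strain (hU hy) (hX.2 y hy) (hne hμν)
      rw [hA.partialDeriv_sectional_succ_succ (hU hy) hμν, hs y hy,
        sectional_succ_succ A hμν] at h
      exact h
    · intro μ ν hμν y hy
      have h := hA.sectional_sub_mul (hU hy) (hX.2 y hy) (Fin.succ_ne_zero ν).symm
        (Fin.succ_ne_zero μ).symm (hne hμν.symm)
      rw [sectional_zero_succ, sectional_succ_succ A hμν] at h
      exact h
    · intro y hy
      obtain ⟨c, hc, hK⟩ := hA.exists_sectional_ne_zero (hU hy) (hRic y (hU hy)) 0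
      obtain ⟨μ, rfl⟩ := Fin.exists_succ_eq.mpr hc
      rw [sectional_comm, sectional_zero_succ] at hK
      exact ⟨μ, hK⟩
    · intro μ y hy
      obtain ⟨c, hc, hK⟩ := hA.exists_sectional_ne_zero (hU hy) (hRic y (hU hy)) μ.succ
      induction c using Fin.cases with
      | zero =>
        rw [sectional_zero_succ] at hK
        exact Or.inl hK
      | succ ν =>
        rw [sectional_succ_succ A fun h => hc (congrArg _ h)] at hK
        exact Or.inr (right_ne_zero_of_mul hK)
  -- The homothety constant is the value of `∂ₜX⁰`, whose differential vanishes on the preconnected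
  -- set `U`.
  obtain ⟨ψ, hconst⟩ := hUo.exists_is_const_of_fderiv_eq_zero (𝕜 := ℝ) hUc
    ((contDiffOn_partialDeriv hUo (hXa 0) 0).differentiableOn (by simp))
    fun y hy => fderiv_eq_zero_of_partialDeriv (hψ y hy)
  refine ⟨hX.1, ψ, fun x hx a b => ?_⟩
  rw [hA.lieMetric_eq (hU hx), metric_apply]
  by_cases hab : a = b
  · subst hab
    have h := (hs x hx a).trans (hconst x hx)
    rw [strain] at h
    simp only [if_true]
    linear_combination 2 * metricDiag A a x * h
  · rw [if_neg hab, if_neg hab]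
    linear_combination hA.shear_eq_zero (hU hx) (hRic x (hU hx)) (hX.2 x hx) hab

end IsProperSpacetime

end BianchiI

end

theorem mainTheorem4 (I : Set ℝ) (A : Fin 3 → ℝ → ℝ)
    (hA : BianchiI.IsProperSpacetime I A)
    (hRic : ∀ x ∈ BianchiI.manifold I, (BianchiI.ricci (BianchiI.metric A) x).det ≠ 0)
    (U : Set BianchiI.Coord) (hUo : IsOpen U) (hUc : IsConnected U)
    (hU : U ⊆ BianchiI.manifold I) :
    (∀ X : BianchiI.VectorField, BianchiI.IsSmoothCC (BianchiI.metric A) U X →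
      BianchiI.IsSmoothHVF (BianchiI.metric A) U X) ∧
    ¬ ∃ X : BianchiI.VectorField, BianchiI.IsProperCC (BianchiI.metric A) U X := by
  have h : ∀ X : BianchiI.VectorField, BianchiI.IsSmoothCC (BianchiI.metric A) U X →
      BianchiI.IsSmoothHVF (BianchiI.metric A) U X := fun X hX =>
    hA.isSmoothHVF_of_isSmoothCC hRic hUo hUc.isPreconnected hU hX
  exact ⟨h, fun ⟨X, hCC, hX⟩ => hX (h X hCC)⟩
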